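/- \textbf{Setting.} Let $d=\sum_{j=1}^r d_j$ with $d_j\ge 1$, let $q_1,\dots,q_d$ be pairwise coprime positive integers and $\Gamma=q_1\mathbb Z\oplus\cdots\oplus q_d\mathbb Z$. Write $n\in\mathbb Z^d$ as $n=(\tilde n_1,\dots,\tilde n_r)$ with consecutive blocks $\tilde n_j\in\mathbb Z^{d_j}$. For any finite tuple of positive integers $(p_i)_{i\in I}$ and any function $X:\mathbb Z^I\to\mathbb C$ which is $p_i$-periodic in its $i$-th variable for every $i\in I$, and $k\in\mathbb R^I$, let $D_X(k)$ be the matrix of the operator $u\mapsto\Delta u+Xu$, $(\Delta u)(n)=\sum_{\|n'-n\|_1=1}u(n')$, acting on the functions $u$ on $\mathbb Z^I$ with $u(n+p_i\mathbf e_i)=e^{2\pi\mathbf i k_i}u(n)$ for all $i\in I$ (identified with their restrictions to $\prod_i\{0,\dots,p_i-1\}$), and let $P_X(k,\lambda)=\det(D_X(k)-\lambda I)$. Two such functions $X,X'$ with the same periods are \emph{Floquet isospectral} if $P_X(k,\lambda)=P_{X'}(k,\lambda)$ for all $k\in\mathbb R^I$ and $\lambda\in\mathbb C$, and \emph{generalized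 Fermi isospectral} if there are $\lambda_1,\lambda_2\in\mathbb C$ such that $P_X(k,\lambda_1)=P_{X'}(k,\lambda_2)$ for all $k\in\mathbb R^I$. \textbf{Theorem.} Let $r\ge 3$ and $d-d_j-d_r\ge 2$ for $j=1,\dots,r-1$. Let $V,Y:\mathbb Z^d\to\mathbb C$ be $\Gamma$-periodic and generalized Fermi isospectral, and suppose that \[V(n)=\sum_{j=1}^{r-1}V_j(\tilde n_j,\tilde n_r),\qquad Y(n)=\sum_{j=1}^{r-1}Y_j(\tilde n_j,\tilde n_r)\qquad(n\in\mathbb Z^d)\] with functions $V_j,Y_j:\mathbb Z^{d_j+d_r}\to\mathbb C$. Then there are functions $U_{j;1},U_{j;2}:\mathbb Z^{d_r}\to\mathbb C$, $j=1,\dots,r-1$, such that for each $j=1,\dots,r-1$ the functions $V_j(\tilde n_j,\tilde n_r)+U_{j;1}(\tilde n_r)$ and $Y_j(\tilde n_j,\tilde n_r)+U_{j;2}(\tilde n_r)$ are periodic with respect to the periods $q_i$ of the variables in the blocks $j$ and $r$, and are Floquet isospectral. -/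

import Mathlib

open scoped BigOperators

noncomputable section

namespace PeriodicSchrodinger

variable {ι : Type*} [Fintype ι] [DecidableEq ι]

/-- `V` is `Γ`-periodic, where `Γ = ⨁ i, q i • ℤ` acts on the lattice `ℤ^ι` by translations. -/
def IsPeriodic (q : ι → ℕ+) (V : (ι → ℤ) → ℂ) : Prop :=
  ∀ (n : ι → ℤ) (i : ι), V (n + Pi.single i ((q i : ℕ) : ℤ)) = V n

/-- The discrete Laplacian on `ℤ^ι`: the sum over the lattice points at `ℓ¹`-distance `1`. -/
def laplacian (u : (ι → ℤ) → ℂ) (n : ι → ℤ) : ℂ :=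
  ∑ i, (u (n + Pi.single i 1) + u (n - Pi.single i 1))

/-- The discrete Schrödinger operator `Δ + V`. -/
def schrodinger (V : (ι → ℤ) → ℂ) (u : (ι → ℤ) → ℂ) (n : ι → ℤ) : ℂ :=
  laplacian u n + V n * u n

/-- The fundamental domain `{n : 0 ≤ n_i ≤ q_i - 1}` of `Γ`. -/
abbrev Cell (q : ι → ℕ+) : Type _ := (i : ι) → Fin (q i : ℕ)

/-- A point of the fundamental domain, as a lattice point. -/
def Cell.toLattice {q : ι → ℕ+} (n : Cell q) : ι → ℤ := fun i => ((n i : ℕ) : ℤ)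

/-- The representative in the fundamental domain of a lattice point modulo `Γ`. -/
def residue (q : ι → ℕ+) (n : ι → ℤ) : Cell q := fun i =>
  ⟨(n i % ((q i : ℕ) : ℤ)).toNat, by
    have h : (0 : ℤ) < ((q i : ℕ) : ℤ) := by exact_mod_cast (q i).pos
    have h1 := Int.emod_lt_of_pos (n i) h
    have h2 := Int.emod_nonneg (n i) h.ne'
    omega⟩

/-- The unique extension of a function on the fundamental domain to a function `u` on the lattice
with the Floquet-Bloch condition `u (n + q_i e_i) = exp (2 π i k_i) u n`. -/
def floquetExtend (q : ι → ℕ+) (k : ι → ℂ) (u : Cell q → ℂ) (n : ι → ℤ) : ℂ :=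
  Complex.exp (2 * Real.pi * Complex.I * ∑ i, k i * ((n i / ((q i : ℕ) : ℤ) : ℤ) : ℂ)) *
    u (residue q n)

/-- The Floquet matrix `D_V(k)`: the matrix of `Δ + V` acting on the functions with the
Floquet-Bloch condition, identified with their restrictions to the fundamental domain. -/
def floquetMatrix (q : ι → ℕ+) (V : (ι → ℤ) → ℂ) (k : ι → ℂ) :
    Matrix (Cell q) (Cell q) ℂ :=
  Matrix.of fun n m => schrodinger V (floquetExtend q k (Pi.single m 1)) n.toLattice

/-- `P_V(k, lam) = det (D_V(k) - lam I)`. -/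
def dispersion (q : ι → ℕ+) (V : (ι → ℤ) → ℂ) (k : ι → ℂ) (lam : ℂ) : ℂ :=
  (floquetMatrix q V k - lam • (1 : Matrix (Cell q) (Cell q) ℂ)).det

/-- `V` and `Y` are Floquet isospectral. -/
def FloquetIsospectral (q : ι → ℕ+) (V Y : (ι → ℤ) → ℂ) : Prop :=
  ∀ (k : ι → ℝ) (lam : ℂ),
    dispersion q V (fun i => (k i : ℂ)) lam = dispersion q Y (fun i => (k i : ℂ)) lam

/-- `V` and `Y` are generalized Fermi isospectral. -/
def GeneralizedFermiIsospectral (q : ι → ℕ+) (V Y : (ι → ℤ) → ℂ) : Prop :=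
  ∃ lam₁ lam₂ : ℂ, ∀ k : ι → ℝ,
    dispersion q V (fun i => (k i : ℂ)) lam₁ = dispersion q Y (fun i => (k i : ℂ)) lam₂

/-- The coordinates of `ℤ^d`, `d = d_1 + ⋯ + d_r` with `r = m + 1`, sorted into `r` consecutive
blocks; the last block has the index `Fin.last m`. -/
abbrev Coord {m : ℕ} (d : Fin (m + 1) → ℕ) : Type := (j : Fin (m + 1)) × Fin (d j)

/-- The coordinates in the block `j` (not the last one) followed by those in the last block. -/
abbrev PairCoord {m : ℕ} (d : Fin (m + 1) → ℕ) (j : Fin m) : Type :=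
  Fin (d j.castSucc) ⊕ Fin (d (Fin.last m))

/-- The components indexed by the block `j` and the last block of a tuple `x` indexed by all
coordinates. -/
def pairBlocks {m : ℕ} {d : Fin (m + 1) → ℕ} {α : Type*} (x : Coord d → α) (j : Fin m) :
    PairCoord d j → α :=
  Sum.elim (fun i => x ⟨j.castSucc, i⟩) (fun i => x ⟨Fin.last m, i⟩)

end PeriodicSchrodinger

end

noncomputable section

namespace PeriodicSchrodinger

open Filter Topology
open scoped Kronecker

/-! ### Floquet matrices: complex quasi-momenta, reindexing of coordinates, exponentials. -/

section General

variable {ι : Type*} [Fintype ι] [DecidableEq ι]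

/-! Fix `j` and average `V` over the variables outside the blocks `j` and `r`. The components with
index other than `j` then contribute only functions of the last block, so the average is `Vc j` plus
such a function (`add_blockCorrection`). It suffices to show that the averages of `V` and `Y`,
shifted by the two energies, are Floquet isospectral.

The identity at the Fermi energies extends to complex quasi-momenta (`dispersion_eq_of_real`). After
a Fourier transform in the averaged variables, the Laplacian there is a diagonal multiplier and the
potential is a matrix whose entry at the trivial character is the average
(`dispersion_eq_det_partialFourier`). The quasi-momenta are sent to complex infinity so that the
multiplier tends to a prescribed `μ` at the trivial character and diverges at all others.
Coprimality and the presence of two averaged variables make this possible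
(`exists_tendsto_freeEigenvalue`). After the diverging rows are normalized, the determinant tends to
the dispersion of the average at energy `lam - μ` (`tendsto_det_partialFourier`). The normalization
is the same for `V` and `Y`, and `μ` is arbitrary, so one pair of energies yields every energy. -/

theorem eq_zero_of_eq_zero_on_real {F : (ι → ℂ) → ℂ} (hF : Differentiable ℂ F)
    (h : ∀ k : ι → ℝ, F (fun i => (k i : ℂ)) = 0) (k : ι → ℂ) : F k = 0 := by
  -- The coordinates are freed from the real line one at a time; `s` is the set of those already
  -- allowed to be complex.
  suffices H : ∀ (s : Finset ι) (k : ι → ℂ), (∀ i ∉ s, ∃ x : ℝ, (x : ℂ) = k i) → F k = 0 from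
    H Finset.univ k (fun i hi => absurd (Finset.mem_univ i) hi)
  intro s
  induction s using Finset.induction_on with
  | empty =>
    intro k hk
    choose x hx using fun i => hk i (Finset.notMem_empty i)
    rw [← funext hx]
    exact h x
  | insert a s ha ih =>
    intro k hk
    have hg : Differentiable ℂ fun t : ℂ => F (Function.update k a t) := by
      refine hF.comp (differentiable_pi.2 fun i => ?_)
      rcases eq_or_ne i a with rfl | hi
      · simp only [Function.update_self]; exact differentiable_id
      · simp only [Function.update_of_ne hi]; exact differentiable_const _
    have hreal : ∀ x : ℝ, F (Function.update k a x) = 0 := fun x => by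
      refine ih _ fun i hi => ?_
      rcases eq_or_ne i a with rfl | hia
      · exact ⟨x, by simp⟩
      · rw [Function.update_of_ne hia]
        exact hk i (by simp [hia, hi])
    -- The real zeros accumulate at `0`, which is all the one-variable identity theorem needs.
    have hfreq : ∃ᶠ t in 𝓝[≠] (0 : ℂ), F (Function.update k a t) = (fun _ => (0 : ℂ)) t := by
      have ht : Tendsto (fun x : ℝ => (x : ℂ)) (𝓝[≠] 0) (𝓝[≠] 0) := by
        refine tendsto_nhdsWithin_iff.2 ⟨?_, ?_⟩
        · exact (Complex.continuous_ofReal.tendsto' 0 0 (by simp)).mono_left nhdsWithin_le_nhds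
        · filter_upwards [self_mem_nhdsWithin] with x hx
          simpa using hx
      exact ht.frequently (Frequently.of_forall hreal)
    have := AnalyticOnNhd.eq_of_frequently_eq
      (fun t _ => hg.analyticAt t) (fun t _ => analyticAt_const) hfreq
    simpa using congrFun this (k a)

theorem differentiable_dispersion (q : ι → ℕ+) (V : (ι → ℤ) → ℂ) (lam : ℂ) :
    Differentiable ℂ fun k : ι → ℂ => dispersion q V k lam := by
  unfold dispersion
  simp only [Matrix.det_apply']
  have hE : ∀ n m, Differentiable ℂ fun k : ι → ℂ =>
      (floquetMatrix q V k - lam • (1 : Matrix (Cell q) (Cell q) ℂ)) n m := by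
    intro n m
    simp only [floquetMatrix, Matrix.sub_apply, Matrix.of_apply, schrodinger, laplacian,
      floquetExtend]
    fun_prop
  exact Differentiable.fun_sum fun σ _ =>
    (differentiable_const _).mul fun x =>
      (HasFDerivAt.finsetProd fun i _ => (hE (σ i) i x).hasFDerivAt).differentiableAt

theorem dispersion_eq_of_real {q : ι → ℕ+} {V Y : (ι → ℤ) → ℂ} {lam₁ lam₂ : ℂ}
    (h : ∀ k : ι → ℝ,
      dispersion q V (fun i => (k i : ℂ)) lam₁ = dispersion q Y (fun i => (k i : ℂ)) lam₂)
    (k : ι → ℂ) : dispersion q V k lam₁ = dispersion q Y k lam₂ :=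
  sub_eq_zero.1 <| eq_zero_of_eq_zero_on_real
    ((differentiable_dispersion q V lam₁).sub (differentiable_dispersion q Y lam₂))
    (fun k => sub_eq_zero.2 (h k)) k

/-- Allows the coordinates to be presented as a disjoint sum of kept and averaged ones. -/
theorem dispersion_reindex {κ : Type*} [Fintype κ] [DecidableEq κ] (e : κ ≃ ι) (q : ι → ℕ+)
    (V : (ι → ℤ) → ℂ) (k : ι → ℂ) (lam : ℂ) :
    dispersion (q ∘ e) (fun n => V (n ∘ e.symm)) (k ∘ e) lam = dispersion q V k lam := by
  let E : Cell q ≃ Cell (q ∘ e) := (Equiv.piCongrLeft' (fun i => Fin (q i : ℕ)) e.symm)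
  have hE : ∀ (c : Cell q) a, E c a = c (e a) := fun c a => rfl
  unfold dispersion
  rw [← Matrix.det_submatrix_equiv_self E]
  congr 1
  have hs : ∀ (a : κ) (x : ℤ), (Pi.single a x : κ → ℤ) ∘ e.symm = Pi.single (e a) x := by
    intro a x
    ext i
    simp only [Function.comp_apply, Pi.single_apply, Equiv.symm_apply_eq]
  have hf : ∀ (m : Cell q) (n : κ → ℤ),
      floquetExtend (q ∘ e) (k ∘ e) (Pi.single (E m) 1) n =
        floquetExtend q k (Pi.single m 1) (n ∘ e.symm) := by
    intro m n
    simp only [floquetExtend]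
    congr 1
    · congr 2
      rw [← Equiv.sum_comp e]
      simp
    · have : residue (q ∘ e) n = E (residue q (n ∘ e.symm)) := by
        ext a
        simp [residue, hE]
      rw [this, Pi.single_apply, Pi.single_apply]
      simp
  have hl : ∀ c : Cell q, (E c).toLattice ∘ e.symm = c.toLattice := by
    intro c
    ext i
    exact congrArg (fun i => ((c i : ℕ) : ℤ)) (e.apply_symm_apply i)
  ext n m
  simp only [Matrix.submatrix_apply, Matrix.sub_apply, Matrix.smul_apply, Matrix.one_apply,
    EmbeddingLike.apply_eq_iff_eq, floquetMatrix, Matrix.of_apply, schrodinger, laplacian, hf, hl]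
  congr 2
  rw [← Equiv.sum_comp e]
  refine Finset.sum_congr rfl fun a _ => ?_
  rw [← hs, ← hl n]
  rfl

theorem floquetMatrix_mulVec (q : ι → ℕ+) (V : (ι → ℤ) → ℂ) (k : ι → ℂ) (u : Cell q → ℂ)
    (n : Cell q) :
    (floquetMatrix q V k).mulVec u n = schrodinger V (floquetExtend q k u) n.toLattice := by
  have hx : ∀ p : ι → ℤ, floquetExtend q k u p =
      ∑ m, floquetExtend q k (Pi.single m 1) p * u m := by
    intro p
    simp only [floquetExtend, mul_assoc, ← Finset.mul_sum]
    simp [Pi.single_apply]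
  simp only [Matrix.mulVec, dotProduct, floquetMatrix, Matrix.of_apply, schrodinger, laplacian, hx,
    add_mul, Finset.sum_add_distrib, Finset.sum_mul, Finset.mul_sum, mul_assoc]
  congr 1
  congr 1
  · rw [Finset.sum_comm]
  · rw [Finset.sum_comm]

theorem laplacian_prod_zpow {w : ι → ℂ} (hw : ∀ i, w i ≠ 0) (n : ι → ℤ) :
    laplacian (fun n => ∏ i, w i ^ n i) n = (∑ i, (w i + (w i)⁻¹)) * ∏ i, w i ^ n i := by
  simp only [laplacian, Finset.sum_mul]
  refine Finset.sum_congr rfl fun a _ => ?_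
  have h : ∀ x : ℤ, ∏ i, w i ^ (n i + Pi.single (M := fun _ => ℤ) a x i) =
      w a ^ x * ∏ i, w i ^ n i := by
    intro x
    simp only [zpow_add₀ (hw _), Finset.prod_mul_distrib]
    rw [mul_comm]
    congr 1
    rw [Finset.prod_eq_single a]
    · simp
    · intro b _ hb; simp [hb]
    · simp
  have h1 := h 1
  have h2 := h (-1)
  simp only [Pi.single_neg, Pi.neg_apply, ← sub_eq_add_neg, zpow_neg, zpow_one] at h1 h2
  simp only [Pi.add_apply, Pi.sub_apply, h1, h2]
  ring

omit [DecidableEq ι] in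
-- The exponential already satisfies the Floquet condition, so extending its restriction returns it.
theorem floquetExtend_prod_zpow {q : ι → ℕ+} {k w : ι → ℂ} (hw : ∀ i, w i ≠ 0)
    (hk : ∀ i, w i ^ (q i : ℕ) = Complex.exp (2 * Real.pi * Complex.I * k i)) (n : ι → ℤ) :
    floquetExtend q k (fun c => ∏ i, w i ^ c.toLattice i) n = ∏ i, w i ^ n i := by
  simp only [floquetExtend, Finset.mul_sum, Complex.exp_sum, ← Finset.prod_mul_distrib]
  refine Finset.prod_congr rfl fun i _ => ?_
  have hq : (0 : ℤ) < ((q i : ℕ) : ℤ) := by exact_mod_cast (q i).pos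
  have h1 : (residue q n).toLattice i = n i % ((q i : ℕ) : ℤ) := by
    simp only [Cell.toLattice, residue]
    exact Int.toNat_of_nonneg (Int.emod_nonneg _ hq.ne')
  rw [h1, show (2 * Real.pi * Complex.I * (k i * ((n i / ((q i : ℕ) : ℤ) : ℤ) : ℂ)) : ℂ) =
    ((n i / ((q i : ℕ) : ℤ) : ℤ) : ℂ) * (2 * Real.pi * Complex.I * k i) by ring,
    Complex.exp_int_mul, ← hk, ← zpow_natCast, ← zpow_mul, ← zpow_add₀ (hw i),
    Int.mul_ediv_add_emod]

end General

/-! ### Separation of variables on a direct sum of lattices. -/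

section Sum

variable {α β : Type*} [Fintype α] [DecidableEq α] [Fintype β] [DecidableEq β]

/-- The fundamental domain of a direct sum of lattices is the product of the fundamental
domains. -/
def cellSumEquiv (q : α ⊕ β → ℕ+) :
    Cell q ≃ Cell (fun a => q (Sum.inl a)) × Cell (fun b => q (Sum.inr b)) :=
  Equiv.sumPiEquivProdPi fun i => Fin (q i : ℕ)

omit [DecidableEq α] [DecidableEq β] in
theorem floquetExtend_mul (q : α ⊕ β → ℕ+) (k : α ⊕ β → ℂ)
    (u : Cell (fun a => q (Sum.inl a)) → ℂ) (v : Cell (fun b => q (Sum.inr b)) → ℂ)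
    (n : α ⊕ β → ℤ) :
    floquetExtend q k (fun c => u (cellSumEquiv q c).1 * v (cellSumEquiv q c).2) n =
      floquetExtend (fun a => q (Sum.inl a)) (fun a => k (Sum.inl a)) u (fun a => n (Sum.inl a)) *
      floquetExtend (fun b => q (Sum.inr b)) (fun b => k (Sum.inr b)) v
        (fun b => n (Sum.inr b)) := by
  simp only [floquetExtend, Fintype.sum_sum_type, mul_add, Complex.exp_add]
  rw [mul_mul_mul_comm]
  rfl

theorem laplacian_mul (u : (α → ℤ) → ℂ) (v : (β → ℤ) → ℂ) (n : α ⊕ β → ℤ) :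
    laplacian (fun n => u (fun a => n (Sum.inl a)) * v (fun b => n (Sum.inr b))) n =
      laplacian u (fun a => n (Sum.inl a)) * v (fun b => n (Sum.inr b)) +
      u (fun a => n (Sum.inl a)) * laplacian v (fun b => n (Sum.inr b)) := by
  have h1 : ∀ i x, (fun a => (Pi.single (Sum.inl i) x : α ⊕ β → ℤ) (Sum.inl a)) =
      Pi.single i x := by
    intro i x; ext a; simp [Pi.single_apply]
  have h2 : ∀ i x, (fun a => (Pi.single (Sum.inl i) x : α ⊕ β → ℤ) (Sum.inr a)) = 0 := by
    intro i x; ext a; simp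
  have h3 : ∀ i x, (fun a => (Pi.single (Sum.inr i) x : α ⊕ β → ℤ) (Sum.inl a)) = 0 := by
    intro i x; ext a; simp
  have h4 : ∀ i x, (fun a => (Pi.single (Sum.inr i) x : α ⊕ β → ℤ) (Sum.inr a)) =
      Pi.single i x := by
    intro i x; ext a; simp [Pi.single_apply]
  have ha : ∀ (p s : α ⊕ β → ℤ), (fun a => (p + s) (Sum.inl a)) =
      (fun a => p (Sum.inl a)) + fun a => s (Sum.inl a) := fun _ _ => rfl
  have hb : ∀ (p s : α ⊕ β → ℤ), (fun a => (p + s) (Sum.inr a)) =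
      (fun a => p (Sum.inr a)) + fun a => s (Sum.inr a) := fun _ _ => rfl
  have ha' : ∀ (p s : α ⊕ β → ℤ), (fun a => (p - s) (Sum.inl a)) =
      (fun a => p (Sum.inl a)) - fun a => s (Sum.inl a) := fun _ _ => rfl
  have hb' : ∀ (p s : α ⊕ β → ℤ), (fun a => (p - s) (Sum.inr a)) =
      (fun a => p (Sum.inr a)) - fun a => s (Sum.inr a) := fun _ _ => rfl
  simp only [laplacian, Fintype.sum_sum_type, ha, hb, ha', hb', h1, h2, h3, h4, add_zero, sub_zero,
    Finset.sum_mul, Finset.mul_sum, add_mul, mul_add]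

theorem schrodinger_mul (V : (α ⊕ β → ℤ) → ℂ) (u : (α → ℤ) → ℂ) (v : (β → ℤ) → ℂ)
    (n : α ⊕ β → ℤ) :
    schrodinger V (fun n => u (fun a => n (Sum.inl a)) * v (fun b => n (Sum.inr b))) n =
      laplacian u (fun a => n (Sum.inl a)) * v (fun b => n (Sum.inr b)) +
      u (fun a => n (Sum.inl a)) * laplacian v (fun b => n (Sum.inr b)) +
      V n * (u (fun a => n (Sum.inl a)) * v (fun b => n (Sum.inr b))) := by
  rw [schrodinger, laplacian_mul]

/-- The average of `V` over the fundamental domain in the variables indexed by `β`. -/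
def cellAverage (q : β → ℕ+) (V : (α ⊕ β → ℤ) → ℂ) (x : α → ℤ) : ℂ :=
  (Fintype.card (Cell q) : ℂ)⁻¹ * ∑ y : Cell q, V (Sum.elim x y.toLattice)

end Sum

/-! ### Characters of the finite quotient group and their orthogonality. -/

section Characters

variable {β : Type*} [Fintype β]

/-- The root of unity `exp (2 π i / p)`. -/
def rootOfUnity (p : ℕ+) : ℂ := Complex.exp (2 * Real.pi * Complex.I / (p : ℕ))

theorem isPrimitiveRoot_rootOfUnity (p : ℕ+) : IsPrimitiveRoot (rootOfUnity p) (p : ℕ) :=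
  Complex.isPrimitiveRoot_exp _ p.ne_zero

theorem rootOfUnity_ne_zero (p : ℕ+) : rootOfUnity p ≠ 0 := Complex.exp_ne_zero _

/-- The Fourier matrix of the finite group `∏ i, ℤ / q i`. -/
def fourierMatrix (q : β → ℕ+) : Matrix (Cell q) (Cell q) ℂ :=
  Matrix.of fun y l => ∏ i, rootOfUnity (q i) ^ ((y i : ℕ) * (l i : ℕ))

/-- The inverse of the Fourier matrix. -/
def fourierMatrixInv (q : β → ℕ+) : Matrix (Cell q) (Cell q) ℂ :=
  Matrix.of fun l y => ∏ i, (((q i : ℕ) : ℂ)⁻¹ * (rootOfUnity (q i) ^ ((y i : ℕ) * (l i : ℕ)))⁻¹)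

theorem sum_rootOfUnity_pow (p : ℕ+) (a b : Fin (p : ℕ)) :
    ∑ y : Fin (p : ℕ), (((p : ℕ) : ℂ)⁻¹ * (rootOfUnity p ^ ((y : ℕ) * (a : ℕ)))⁻¹) *
      rootOfUnity p ^ ((y : ℕ) * (b : ℕ)) = if a = b then 1 else 0 := by
  have hp : ((p : ℕ) : ℂ) ≠ 0 := by exact_mod_cast p.ne_zero
  have h0 := rootOfUnity_ne_zero p
  set r := rootOfUnity p with hr
  have hterm : ∀ y : Fin (p : ℕ), (((p : ℕ) : ℂ)⁻¹ * (r ^ ((y : ℕ) * (a : ℕ)))⁻¹) *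
      r ^ ((y : ℕ) * (b : ℕ)) = ((p : ℕ) : ℂ)⁻¹ * ((r ^ (a : ℕ))⁻¹ * r ^ (b : ℕ)) ^ (y : ℕ) := by
    intro y
    rw [mul_pow, inv_pow, ← pow_mul, ← pow_mul, mul_comm (a : ℕ), mul_comm (b : ℕ), mul_assoc]
  simp only [hterm, ← Finset.mul_sum]
  rw [Fin.sum_univ_eq_sum_range (fun y => ((r ^ (a : ℕ))⁻¹ * r ^ (b : ℕ)) ^ y)]
  split_ifs with hab
  · subst hab
    rw [inv_mul_cancel₀ (pow_ne_zero _ h0)]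
    simp [hp]
  · have h1 : (r ^ (a : ℕ))⁻¹ * r ^ (b : ℕ) ≠ 1 := by
      intro h
      rw [inv_mul_eq_one₀ (pow_ne_zero _ h0)] at h
      exact hab (Fin.ext ((isPrimitiveRoot_rootOfUnity p).pow_inj a.2 b.2 h))
    have hrp : ∀ c : ℕ, (r ^ c) ^ (p : ℕ) = 1 := fun c => by
      rw [pow_right_comm, (isPrimitiveRoot_rootOfUnity p).pow_eq_one, one_pow]
    have h2 : ((r ^ (a : ℕ))⁻¹ * r ^ (b : ℕ)) ^ (p : ℕ) = 1 := by
      rw [mul_pow, inv_pow, hrp, hrp, inv_one, one_mul]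
    rw [geom_sum_eq h1, h2]
    simp

variable [DecidableEq β]

theorem fourierMatrixInv_mul (q : β → ℕ+) : fourierMatrixInv q * fourierMatrix q = 1 := by
  ext l l'
  simp only [Matrix.mul_apply, fourierMatrixInv, fourierMatrix, Matrix.of_apply,
    ← Finset.prod_mul_distrib, Matrix.one_apply]
  rw [← Fintype.piFinset_univ, ← Finset.prod_univ_sum (fun i => (Finset.univ : Finset (Fin (q i : ℕ))))
    (fun i y => ((q i : ℕ) : ℂ)⁻¹ * (rootOfUnity (q i) ^ ((y : ℕ) * (l i : ℕ)))⁻¹ *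
      rootOfUnity (q i) ^ ((y : ℕ) * (l' i : ℕ)))]
  simp only [sum_rootOfUnity_pow]
  rw [Finset.prod_ite_zero]
  simp [funext_iff]

theorem fourierMatrix_mul (q : β → ℕ+) : fourierMatrix q * fourierMatrixInv q = 1 :=
  mul_eq_one_comm.1 (fourierMatrixInv_mul q)

theorem det_fourierMatrix_ne_zero (q : β → ℕ+) : (fourierMatrix q).det ≠ 0 := by
  intro h
  have := congrArg Matrix.det (fourierMatrix_mul q)
  rw [Matrix.det_mul, h] at this
  simp at this

/-- The trivial character. -/
def cellZero (q : β → ℕ+) : Cell q := fun i => ⟨0, (q i).pos⟩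

end Characters

/-! ### Fourier transform in the averaged variables. -/

section PartialFourier

variable {α β : Type*} [Fintype α] [DecidableEq α] [Fintype β] [DecidableEq β]

omit [DecidableEq α] in
theorem floquetExtend_toLattice (q : α → ℕ+) (k : α → ℂ) (u : Cell q → ℂ) (c : Cell q) :
    floquetExtend q k u c.toLattice = u c := by
  have h1 : ∀ i, c.toLattice i / ((q i : ℕ) : ℤ) = 0 := fun i =>
    Int.ediv_eq_zero_of_lt (Int.natCast_nonneg _) (Int.ofNat_lt.2 (c i).2)
  have h2 : residue q c.toLattice = c := by
    ext i
    have : ((c i : ℕ) : ℤ) % ((q i : ℕ) : ℤ) = ((c i : ℕ) : ℤ) :=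
      Int.emod_eq_of_lt (Int.natCast_nonneg _) (Int.ofNat_lt.2 (c i).2)
    simp only [residue, Cell.toLattice, this, Int.toNat_natCast]
  simp [floquetExtend, h1, h2]

theorem floquetMatrix_eq_add_diagonal (q : α → ℕ+) (V : (α → ℤ) → ℂ) (k : α → ℂ) :
    floquetMatrix q V k = floquetMatrix q 0 k + Matrix.diagonal fun c => V c.toLattice := by
  ext m m'
  simp [floquetMatrix, schrodinger, floquetExtend_toLattice, Matrix.diagonal_apply,
    Pi.single_apply]

/-- The eigenvalues of the Laplacian on the exponentials `n ↦ ∏ i, (z i * ρ i ^ l i) ^ n i`, where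
`ρ i` is the root of unity of order `q i`. -/
def freeEigenvalue (q : β → ℕ+) (z : β → ℂ) (l : Cell q) : ℂ :=
  ∑ i, (z i * rootOfUnity (q i) ^ (l i : ℕ) + (z i * rootOfUnity (q i) ^ (l i : ℕ))⁻¹)

/-- The conjugate of the multiplication by a function on the fundamental domain under the Fourier
transform. -/
def fourierConj (q : β → ℕ+) (v : Cell q → ℂ) : Matrix (Cell q) (Cell q) ℂ :=
  fourierMatrixInv q * Matrix.diagonal v * fourierMatrix q

/-- The operator `Δ + V` after a Fourier transform in the variables indexed by `β`, with the
Laplacian in these variables replaced by the multiplier `a`. -/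
def partialFourier (q : α ⊕ β → ℕ+) (V : (α ⊕ β → ℤ) → ℂ) (k : α → ℂ)
    (a : Cell (fun b => q (Sum.inr b)) → ℂ) :
    Matrix (Cell (fun a => q (Sum.inl a)) × Cell (fun b => q (Sum.inr b)))
      (Cell (fun a => q (Sum.inl a)) × Cell (fun b => q (Sum.inr b))) ℂ :=
  Matrix.of fun p p' =>
    (if p.2 = p'.2 then floquetMatrix (fun a => q (Sum.inl a)) 0 k p.1 p'.1 +
      (if p.1 = p'.1 then a p.2 else 0) else 0) +
    if p.1 = p'.1 then
      fourierConj _ (fun y => V (Sum.elim p.1.toLattice y.toLattice)) p.2 p'.2 else 0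

/-- The change of basis is `1 ⊗ₖ E`, where the columns of `E` are exponentials with the given
Floquet multipliers: they are eigenfunctions of the Laplacian in the `β` variables. The factor of
`E` coming from `z` is diagonal and commutes with the potential, so the conjugated potential does
not depend on `z`. Nothing requires `z` to have modulus one. -/
theorem dispersion_eq_det_partialFourier (q : α ⊕ β → ℕ+) (V : (α ⊕ β → ℤ) → ℂ) (k : α ⊕ β → ℂ)
    (z : β → ℂ) (hz : ∀ i, z i ≠ 0)
    (hk : ∀ i, z i ^ (q (Sum.inr i) : ℕ) =
      Complex.exp (2 * Real.pi * Complex.I * k (Sum.inr i))) (lam : ℂ) :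
    dispersion q V k lam =
      (partialFourier q V (fun a => k (Sum.inl a)) fun l =>
        freeEigenvalue (fun b => q (Sum.inr b)) z l - lam).det := by
  set qa : α → ℕ+ := fun a => q (Sum.inl a)
  set qb : β → ℕ+ := fun b => q (Sum.inr b)
  let e : Cell q ≃ Cell qa × Cell qb := cellSumEquiv q
  let w : Cell qb → β → ℂ := fun l i => z i * rootOfUnity (qb i) ^ (l i : ℕ)
  have hw : ∀ l i, w l i ≠ 0 := fun l i => mul_ne_zero (hz i) (pow_ne_zero _ (rootOfUnity_ne_zero _))
  have hwk : ∀ l i, w l i ^ (qb i : ℕ) =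
      Complex.exp (2 * Real.pi * Complex.I * k (Sum.inr i)) := by
    intro l i
    simp only [w]
    rw [mul_pow, pow_right_comm, (isPrimitiveRoot_rootOfUnity _).pow_eq_one, one_pow, mul_one]
    exact hk i
  let v : Cell qb → ℂ := fun y => ∏ i, z i ^ (y i : ℕ)
  let E : Matrix (Cell qb) (Cell qb) ℂ := Matrix.diagonal v * fourierMatrix qb
  have hE : ∀ y l, E y l = ∏ i, w l i ^ y.toLattice i := by
    intro y l
    simp only [E, v, Matrix.diagonal_mul, fourierMatrix, Matrix.of_apply,
      ← Finset.prod_mul_distrib, w, Cell.toLattice, zpow_natCast]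
    refine Finset.prod_congr rfl fun i _ => ?_
    rw [mul_pow, ← pow_mul, mul_comm (l i : ℕ)]
  have hEdet : E.det ≠ 0 := by
    rw [Matrix.det_mul, Matrix.det_diagonal]
    exact mul_ne_zero (Finset.prod_ne_zero_iff.2 fun y _ => Finset.prod_ne_zero_iff.2
      fun i _ => pow_ne_zero _ (hz i)) (det_fourierMatrix_ne_zero qb)
  have hEV : ∀ u : Cell qb → ℂ, E * fourierConj qb u = Matrix.diagonal u * E := by
    intro u
    calc E * fourierConj qb u
        = Matrix.diagonal v * (fourierMatrix qb * fourierMatrixInv qb) * Matrix.diagonal u *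
          fourierMatrix qb := by simp only [E, fourierConj, Matrix.mul_assoc]
      _ = Matrix.diagonal u * E := by
          simp only [fourierMatrix_mul, Matrix.mul_one, Matrix.diagonal_mul_diagonal,
            mul_comm (v _), E, ← Matrix.mul_assoc]
  let F : Matrix (Cell qa × Cell qb) (Cell qa × Cell qb) ℂ := (1 : Matrix (Cell qa) (Cell qa) ℂ) ⊗ₖ E
  have hFdet : F.det ≠ 0 := by
    rw [Matrix.det_kronecker]
    simp [hEdet]
  set D : Matrix (Cell qa × Cell qb) (Cell qa × Cell qb) ℂ :=
    (floquetMatrix q V k - lam • (1 : Matrix (Cell q) (Cell q) ℂ)).submatrix e.symm e.symm with hD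
  have hdet : dispersion q V k lam = D.det := by
    rw [hD, Matrix.det_submatrix_equiv_self]; rfl
  rw [hdet]
  refine mul_right_cancel₀ hFdet ?_
  -- Similarity is proved as the intertwining relation of `D` and the transformed matrix through
  -- `F`, which avoids inverting `F`.
  rw [← Matrix.det_mul, mul_comm, ← Matrix.det_mul]
  congr 1
  ext ⟨m, y⟩ ⟨m', l⟩
  have hL : (D * F) (m, y) (m', l) =
      schrodinger V (floquetExtend q k fun c => (Pi.single m' 1 : Cell qa → ℂ) (e c).1 *
        ∏ i, w l i ^ (e c).2.toLattice i) (e.symm (m, y)).toLattice - lam * F (m, y) (m', l) := by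
    have h1 : D = (floquetMatrix q V k).submatrix e.symm e.symm -
        lam • (1 : Matrix (Cell qa × Cell qb) (Cell qa × Cell qb) ℂ) := by
      rw [hD, Matrix.submatrix_sub, Matrix.submatrix_smul]
      simp
    rw [h1, Matrix.sub_mul, Matrix.sub_apply, Matrix.smul_mul, Matrix.one_mul, Matrix.smul_apply,
      smul_eq_mul, ← floquetMatrix_mulVec]
    congr 1
    simp only [Matrix.mul_apply, Matrix.mulVec, dotProduct, Matrix.submatrix_apply]
    rw [← Equiv.sum_comp e]
    refine Finset.sum_congr rfl fun c _ => ?_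
    rw [e.symm_apply_apply]
    congr 1
    simp only [F, Matrix.kroneckerMap_apply, hE, Matrix.one_apply, Pi.single_apply]
  have hfe : (floquetExtend q k fun c => (Pi.single m' 1 : Cell qa → ℂ) (e c).1 *
        ∏ i, w l i ^ (e c).2.toLattice i) = fun n =>
      (floquetExtend qa (fun a => k (Sum.inl a)) (Pi.single m' 1)) (fun a => n (Sum.inl a)) *
        (fun p : β → ℤ => ∏ i, w l i ^ p i) (fun b => n (Sum.inr b)) := by
    ext n
    refine (floquetExtend_mul q k (Pi.single m' 1) (fun c => ∏ i, w l i ^ c.toLattice i) n).trans ?_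
    rw [floquetExtend_prod_zpow (hw l) (hwk l)]
  have hn : (e.symm (m, y)).toLattice = Sum.elim m.toLattice y.toLattice := by
    ext (i | i) <;> rfl
  have hA : laplacian (floquetExtend qa (fun a => k (Sum.inl a)) (Pi.single m' 1)) m.toLattice =
      floquetMatrix qa 0 (fun a => k (Sum.inl a)) m m' := by
    simp [floquetMatrix, schrodinger]
  have hR : (F * partialFourier q V (fun a => k (Sum.inl a)) fun l =>
        freeEigenvalue qb z l - lam) (m, y) (m', l) =
      E y l * (floquetMatrix qa 0 (fun a => k (Sum.inl a)) m m' +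
        (if m = m' then freeEigenvalue qb z l - lam else 0)) +
      if m = m' then V (Sum.elim m.toLattice y.toLattice) * E y l else 0 := by
    have h2 := congrFun (congrFun (hEV fun y => V (Sum.elim m.toLattice y.toLattice)) y) l
    rw [Matrix.diagonal_mul] at h2
    rw [← h2, Matrix.mul_apply, Fintype.sum_prod_type, Finset.sum_eq_single m]
    · simp only [F, Matrix.kroneckerMap_apply, Matrix.one_apply_eq, one_mul, partialFourier,
        Matrix.of_apply, mul_add, Finset.sum_add_distrib, mul_ite, mul_zero, Finset.sum_ite_eq',
        Finset.mem_univ, if_true]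
      congr 1
      split_ifs
      · rw [Matrix.mul_apply]
      · exact Finset.sum_const_zero
    · intro b _ hb
      simp [F, Matrix.one_apply_ne hb.symm]
    · simp
  have hS : schrodinger V (floquetExtend q k fun c => (Pi.single m' 1 : Cell qa → ℂ) (e c).1 *
        ∏ i, w l i ^ (e c).2.toLattice i) (e.symm (m, y)).toLattice =
      floquetMatrix qa 0 (fun a => k (Sum.inl a)) m m' * E y l +
      (Pi.single m' 1 : Cell qa → ℂ) m * (freeEigenvalue qb z l * E y l) +
      V (Sum.elim m.toLattice y.toLattice) * ((Pi.single m' 1 : Cell qa → ℂ) m * E y l) := by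
    rw [hfe, hn]
    refine (schrodinger_mul V (floquetExtend qa (fun a => k (Sum.inl a)) (Pi.single m' 1))
      (fun p : β → ℤ => ∏ i, w l i ^ p i) (Sum.elim m.toLattice y.toLattice)).trans ?_
    simp only [Sum.elim_inl, Sum.elim_inr]
    rw [laplacian_prod_zpow (hw l), ← hA, hE, floquetExtend_toLattice]
    rfl
  have hF : F (m, y) (m', l) = if m = m' then E y l else 0 := by
    simp [F, Matrix.kroneckerMap_apply, Matrix.one_apply]
  rw [hL, hR, hS, hF]
  by_cases hm : m = m'
  · simp only [hm, Pi.single_eq_same, if_true]; ring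
  · simp only [if_neg hm, Pi.single_eq_of_ne hm]; ring

end PartialFourier

/-! ### The limit of large complex quasi-momenta. -/

section Limit

variable {α β : Type*} [Fintype α] [DecidableEq α] [Fintype β] [DecidableEq β]

/-- The source of the average: the trivial character is constant. -/
theorem fourierConj_cellZero (q : β → ℕ+) (v : Cell q → ℂ) :
    fourierConj q v (cellZero q) (cellZero q) = (Fintype.card (Cell q) : ℂ)⁻¹ * ∑ y, v y := by
  rw [fourierConj, Matrix.mul_apply]
  simp [Matrix.mul_diagonal, fourierMatrixInv, fourierMatrix, cellZero, Finset.mul_sum]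

/-- The factor that normalizes the row of a nontrivial character. -/
def rowScale (q : β → ℕ+) (a : Cell q → ℂ) (l : Cell q) : ℂ :=
  if l = cellZero q then 1 else (a l)⁻¹

/-- The limit of the normalized matrices: the rows of the nontrivial characters become trivial. -/
def limitMatrix (q : α ⊕ β → ℕ+) (V : (α ⊕ β → ℤ) → ℂ) (k : α → ℂ) (μ : ℂ) :
    Matrix (Cell (fun a => q (Sum.inl a)) × Cell (fun b => q (Sum.inr b)))
      (Cell (fun a => q (Sum.inl a)) × Cell (fun b => q (Sum.inr b))) ℂ :=
  Matrix.of fun p p' => if p.2 = cellZero _ then partialFourier q V k (fun _ => μ) p p'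
    else if p = p' then 1 else 0

/-- Rows of nontrivial characters are rows of the identity, so the matrix is block triangular and
only the block of the trivial character counts. There `μ` is added on the diagonal, hence the energy
`-μ`. -/
theorem det_limitMatrix (q : α ⊕ β → ℕ+) (V : (α ⊕ β → ℤ) → ℂ) (k : α → ℂ) (μ : ℂ) :
    (limitMatrix q V k μ).det =
      dispersion (fun a => q (Sum.inl a)) (cellAverage (fun b => q (Sum.inr b)) V) k (-μ) := by
  rw [Matrix.twoBlockTriangular_det (limitMatrix q V k μ) (fun p => p.2 = cellZero _)]
  · have h1 : (Matrix.toSquareBlockProp (limitMatrix q V k μ)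
        fun p => ¬ p.2 = cellZero (fun b => q (Sum.inr b))) = 1 := by
      ext p p'
      simp only [Matrix.toSquareBlockProp_def, limitMatrix, Matrix.of_apply, if_neg p.2,
        Matrix.one_apply, Subtype.ext_iff]
    rw [h1, Matrix.det_one, mul_one, dispersion]
    let e : Cell (fun a => q (Sum.inl a)) ≃
        {p : Cell (fun a => q (Sum.inl a)) × Cell (fun b => q (Sum.inr b)) //
          p.2 = cellZero (fun b => q (Sum.inr b))} :=
      { toFun := fun m => ⟨(m, cellZero _), rfl⟩
        invFun := fun p => p.1.1
        left_inv := fun m => rfl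
        right_inv := fun p => Subtype.ext (Prod.ext rfl p.2.symm) }
    rw [← Matrix.det_submatrix_equiv_self e]
    congr 1
    ext m m'
    rw [floquetMatrix_eq_add_diagonal]
    simp only [Matrix.submatrix_apply, Matrix.toSquareBlockProp_def, limitMatrix, Matrix.of_apply,
      e, Equiv.coe_fn_mk, if_true, partialFourier, fourierConj_cellZero, Matrix.sub_apply,
      Matrix.add_apply, Matrix.diagonal_apply, Matrix.smul_apply, Matrix.one_apply, smul_eq_mul,
      cellAverage]
    split_ifs <;> ring
  · rintro ⟨m, l⟩ hl ⟨m', l'⟩ hl'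
    simp only at hl hl'
    simp only [limitMatrix, Matrix.of_apply, if_neg hl, Prod.mk.injEq]
    rw [if_neg]
    rintro ⟨-, h⟩
    exact hl (h.trans hl')

/-- In a row where `a t l` diverges, division by it sends the diagonal entry to `1` and the others
to `0`. The remaining rows converge unscaled, and the determinant is continuous. -/
theorem tendsto_det_partialFourier (q : α ⊕ β → ℕ+) (V : (α ⊕ β → ℤ) → ℂ) (k : α → ℂ) (lam μ : ℂ)
    {a : ℕ → Cell (fun b => q (Sum.inr b)) → ℂ}
    (h0 : Tendsto (fun t => a t (cellZero _)) atTop (𝓝 μ))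
    (h : ∀ l, l ≠ cellZero _ → Tendsto (fun t => a t l) atTop (Bornology.cobounded ℂ)) :
    Tendsto (fun t => (∏ p : Cell (fun a => q (Sum.inl a)) × Cell (fun b => q (Sum.inr b)),
        rowScale _ (a t) p.2) * (partialFourier q V k fun l => a t l - lam).det) atTop
      (𝓝 (dispersion (fun a => q (Sum.inl a)) (cellAverage (fun b => q (Sum.inr b)) V) k
        (lam - μ))) := by
  have hinv : ∀ l, l ≠ cellZero _ → Tendsto (fun t => (a t l)⁻¹) atTop (𝓝 0) := fun l hl =>
    tendsto_inv₀_cobounded.comp (h l hl)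
  have hone : ∀ l, l ≠ cellZero _ → Tendsto (fun t => (a t l)⁻¹ * (a t l - lam)) atTop (𝓝 1) := by
    intro l hl
    have h1 : Tendsto (fun t => 1 - (a t l)⁻¹ * lam) atTop (𝓝 1) := by
      simpa using ((hinv l hl).mul_const lam).const_sub 1
    refine h1.congr' ?_
    have hne : ∀ᶠ t in atTop, a t l ≠ 0 := (h l hl).eventually (Bornology.eventually_ne_cobounded 0)
    filter_upwards [hne] with t ht
    rw [mul_sub, inv_mul_cancel₀ ht]
  rw [show lam - μ = -(μ - lam) by ring, ← det_limitMatrix]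
  have hcont : Continuous fun M : Matrix (Cell (fun a => q (Sum.inl a)) ×
      Cell (fun b => q (Sum.inr b))) (Cell (fun a => q (Sum.inl a)) ×
      Cell (fun b => q (Sum.inr b))) ℂ => M.det := continuous_id.matrix_det
  -- The product of the factors is absorbed into the determinant as a scaling of rows.
  simp only [← Matrix.det_mul_column]
  refine (hcont.tendsto _).comp ?_
  refine tendsto_pi_nhds.2 fun p => tendsto_pi_nhds.2 fun p' => ?_
  obtain ⟨m, l⟩ := p
  obtain ⟨m', l'⟩ := p'
  by_cases hl : l = cellZero _
  · simp only [Matrix.of_apply, rowScale, limitMatrix, hl, if_true, one_mul, partialFourier]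
    refine Tendsto.add ?_ tendsto_const_nhds
    split_ifs
    · exact (h0.sub_const lam).const_add _
    · exact tendsto_const_nhds
    · exact tendsto_const_nhds
  · simp only [Matrix.of_apply, rowScale, limitMatrix, hl, if_false, partialFourier]
    have hz : ∀ c : ℂ, Tendsto (fun t => (a t l)⁻¹ * c) atTop (𝓝 0) := fun c => by
      simpa using (hinv l hl).mul_const c
    have hz2 := hone l hl
    by_cases h1 : l = l' <;> by_cases h2 : m = m' <;>
      simp only [h1, h2, if_true, if_false, Prod.mk.injEq, and_true, and_false, mul_add, add_zero,
        mul_zero] at hz hz2 ⊢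
    · simpa using ((hz _).add hz2).add (hz _)
    · exact hz _
    · simpa using hz _
    · exact tendsto_const_nhds

/-- Two potentials whose dispersion relations agree at the energies `lam₁`, `lam₂` have averages
with the same dispersion relations up to the energy shift, if the free eigenvalues in the averaged
variables can be made divergent except for the trivial character. -/
theorem dispersion_cellAverage_eq {q : α ⊕ β → ℕ+} {V Y : (α ⊕ β → ℤ) → ℂ} {lam₁ lam₂ μ : ℂ}
    (hVY : ∀ k, dispersion q V k lam₁ = dispersion q Y k lam₂)
    {z : ℕ → β → ℂ} (hz : ∀ᶠ t in atTop, ∀ i, z t i ≠ 0)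
    (h0 : Tendsto (fun t => freeEigenvalue (fun b => q (Sum.inr b)) (z t) (cellZero _)) atTop (𝓝 μ))
    (h : ∀ l, l ≠ cellZero _ → Tendsto (fun t => freeEigenvalue (fun b => q (Sum.inr b)) (z t) l)
      atTop (Bornology.cobounded ℂ)) (k : α → ℂ) :
    dispersion (fun a => q (Sum.inl a)) (cellAverage (fun b => q (Sum.inr b)) V) k (lam₁ - μ) =
      dispersion (fun a => q (Sum.inl a)) (cellAverage (fun b => q (Sum.inr b)) Y) k
        (lam₂ - μ) := by
  -- The row factors involve neither the potential nor the energy, so both sequences agree before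
  -- the limit.
  refine tendsto_nhds_unique_of_eventuallyEq (tendsto_det_partialFourier q V k lam₁ μ h0 h)
    (tendsto_det_partialFourier q Y k lam₂ μ h0 h) ?_
  filter_upwards [hz] with t ht
  -- A logarithm realizes `z t` by quasi-momenta; these are complex in general, which is why `hVY`
  -- is needed beyond real ones.
  let κ : α ⊕ β → ℂ := Sum.elim k fun i =>
    Complex.log (z t i ^ (q (Sum.inr i) : ℕ)) / (2 * Real.pi * Complex.I)
  have hκ : ∀ i, z t i ^ (q (Sum.inr i) : ℕ) =
      Complex.exp (2 * Real.pi * Complex.I * κ (Sum.inr i)) := by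
    intro i
    simp only [κ, Sum.elim_inr]
    rw [mul_div_cancel₀ _ Complex.two_pi_I_ne_zero, Complex.exp_log (pow_ne_zero _ (ht i))]
  have := hVY κ
  rw [dispersion_eq_det_partialFourier q V κ (z t) ht hκ,
    dispersion_eq_det_partialFourier q Y κ (z t) ht hκ] at this
  simp only [κ, Sum.elim_inl] at this
  rw [this]

end Limit

/-! ### Directions in which only the trivial character stays bounded. -/

section Directions

variable {β : Type*} [Fintype β] [DecidableEq β]

/-- Finitely many functionals, none vanishing on the hyperplane `∑ i, c i = 0`, are simultaneously
nonzero at some point of it. A functional vanishing there has equal coefficients. This fails for a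
coordinate, as there are two of them; for a character, equal roots of unity of coprime orders are
`1`, so the character is trivial. -/
theorem exists_direction {q : β → ℕ+} (hq : Pairwise fun a b => Nat.Coprime (q a : ℕ) (q b : ℕ))
    (hβ : Nontrivial β) :
    ∃ c : β → ℂ, ∑ i, c i = 0 ∧ (∀ i, c i ≠ 0) ∧
      ∀ l : Cell q, l ≠ cellZero q → ∑ i, c i * rootOfUnity (q i) ^ (l i : ℕ) ≠ 0 := by
  let φ : (β → ℂ) → Module.Dual ℂ (β → ℂ) := fun x => ∑ i, x i • LinearMap.proj i
  have hφ : ∀ x c, φ x c = ∑ i, c i * x i := by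
    intro x c
    simp [φ, mul_comm]
  have hdiff : ∀ (x : β → ℂ) (i j : β), φ x (Pi.single i 1 - Pi.single j 1) = x i - x j := by
    intro x i j
    simp [hφ, sub_mul, Finset.sum_sub_distrib, Pi.single_apply]
  let f : β ⊕ {l : Cell q // l ≠ cellZero q} → Module.Dual ℂ (β → ℂ) :=
    Sum.elim (fun i => φ (Pi.single i 1))
      fun l => φ fun i => rootOfUnity (q i) ^ (l.1 i : ℕ)
  obtain ⟨c, hc, hf⟩ := Module.Dual.exists_forall_mem_ne_zero_of_forall_exists
    (LinearMap.ker (φ fun _ => 1)) f (by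
      rintro (i | ⟨l, hl⟩)
      · obtain ⟨j, hj⟩ := exists_ne i
        refine ⟨Pi.single i 1 - Pi.single j 1, ?_, ?_⟩
        · rw [LinearMap.mem_ker, hdiff, sub_self]
        · simp only [f, Sum.elim_inl, hdiff]
          simp [hj]
      · by_contra! hcon
        have heq : ∀ i j, rootOfUnity (q i) ^ (l i : ℕ) = rootOfUnity (q j) ^ (l j : ℕ) := by
          intro i j
          have := hcon (Pi.single i 1 - Pi.single j 1) (by rw [LinearMap.mem_ker, hdiff, sub_self])
          simp only [f, Sum.elim_inr, hdiff] at this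
          exact sub_eq_zero.1 this
        refine hl (funext fun i => Fin.ext ?_)
        obtain ⟨j, hj⟩ := exists_ne i
        have hone : ∀ j, (rootOfUnity (q j) ^ (l j : ℕ)) ^ (q j : ℕ) = 1 := fun j => by
          rw [pow_right_comm, (isPrimitiveRoot_rootOfUnity _).pow_eq_one, one_pow]
        have h1 : rootOfUnity (q i) ^ (l i : ℕ) = 1 := by
          have := orderOf_dvd_of_pow_eq_one (hone i)
          have h2 := hone j
          rw [heq j i] at h2
          -- The common value has order dividing both `q i` and `q j`.
          have h3 := Nat.dvd_gcd this (orderOf_dvd_of_pow_eq_one h2)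
          rw [(hq hj.symm).gcd_eq_one, Nat.dvd_one, orderOf_eq_one_iff] at h3
          exact h3
        exact (isPrimitiveRoot_rootOfUnity (q i)).pow_inj (l i).2 (q i).pos (by simpa [cellZero] using h1))
  refine ⟨c, ?_, fun i => ?_, fun l hl => ?_⟩
  · simpa [hφ] using hc
  · simpa [f, hφ, Pi.single_apply] using hf (Sum.inl i)
  · simpa [f, hφ] using hf (Sum.inr ⟨l, hl⟩)

omit [DecidableEq β] in
-- Along the line `c i * t + b i` the inverse terms die out, and the eigenvalue is asymptotically
-- affine in `t`.
theorem tendsto_freeEigenvalue_sub {q : β → ℕ+} {c : β → ℂ} (b : β → ℂ) (hc : ∀ i, c i ≠ 0)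
    (l : Cell q) :
    Tendsto (fun t : ℕ => freeEigenvalue q (fun i => c i * t + b i) l -
      (∑ i, c i * rootOfUnity (q i) ^ (l i : ℕ)) * t) atTop
      (𝓝 (∑ i, b i * rootOfUnity (q i) ^ (l i : ℕ))) := by
  have h1 : ∀ i, Tendsto (fun t : ℕ => ((c i * (t : ℂ) + b i) * rootOfUnity (q i) ^ (l i : ℕ))⁻¹)
      atTop (𝓝 0) := fun i =>
    tendsto_inv₀_cobounded.comp <|
      (tendsto_mul_right_cobounded (pow_ne_zero _ (rootOfUnity_ne_zero _))).comp <|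
        (tendsto_add_const_cobounded _).comp <| (tendsto_mul_left_cobounded (hc i)).comp
          tendsto_natCast_atTop_cobounded
  have h2 := (tendsto_finsetSum Finset.univ fun i _ => h1 i).const_add
    (∑ i, b i * rootOfUnity (q i) ^ (l i : ℕ))
  rw [Finset.sum_const_zero, add_zero] at h2
  refine h2.congr fun t => ?_
  simp only [freeEigenvalue, Finset.sum_mul, Finset.sum_add_distrib, add_mul]
  have : ∀ i, c i * (t : ℂ) * rootOfUnity (q i) ^ (l i : ℕ) =
    c i * rootOfUnity (q i) ^ (l i : ℕ) * t := fun i => by ring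
  simp only [this]
  ring

theorem exists_tendsto_freeEigenvalue {q : β → ℕ+}
    (hq : Pairwise fun a b => Nat.Coprime (q a : ℕ) (q b : ℕ)) (hβ : Nontrivial β) (μ : ℂ) :
    ∃ z : ℕ → β → ℂ, (∀ᶠ t in atTop, ∀ i, z t i ≠ 0) ∧
      Tendsto (fun t => freeEigenvalue q (z t) (cellZero q)) atTop (𝓝 μ) ∧
      ∀ l, l ≠ cellZero q →
        Tendsto (fun t => freeEigenvalue q (z t) l) atTop (Bornology.cobounded ℂ) := by
  obtain ⟨c, hsum, hc, hl⟩ := exists_direction hq hβ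
  -- At the trivial character the slope `∑ i, c i` is zero and the constant terms add up to `μ`; at
  -- any other character the slope is nonzero.
  refine ⟨fun t i => c i * t + μ / Fintype.card β, ?_, ?_, fun l hl0 => ?_⟩
  · refine eventually_all.2 fun i => ?_
    exact ((tendsto_add_const_cobounded _).comp <| (tendsto_mul_left_cobounded (hc i)).comp
          tendsto_natCast_atTop_cobounded).eventually (Bornology.eventually_ne_cobounded 0)
  · have h := tendsto_freeEigenvalue_sub (fun _ => μ / Fintype.card β) hc (cellZero q)
    have hcard : (Fintype.card β : ℂ) ≠ 0 := by
      exact_mod_cast Fintype.card_ne_zero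
    simpa [cellZero, hsum, mul_div_cancel₀ _ hcard] using h
  · have h := (tendsto_freeEigenvalue_sub (fun _ => μ / Fintype.card β) hc l).norm.neg
    have hS : Tendsto (fun t : ℕ => ‖(∑ i, c i * rootOfUnity (q i) ^ (l i : ℕ)) * (t : ℂ)‖)
        atTop atTop :=
      tendsto_norm_cobounded_atTop.comp <| (tendsto_mul_left_cobounded (hl l hl0)).comp
        tendsto_natCast_atTop_cobounded
    rw [← tendsto_norm_atTop_iff_cobounded]
    refine tendsto_atTop_mono (fun t => ?_) (hS.atTop_add h)
    rw [← sub_eq_add_neg, sub_le_iff_le_add]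
    calc _ = ‖freeEigenvalue q (fun i => c i * t + μ / Fintype.card β) l -
          (freeEigenvalue q (fun i => c i * t + μ / Fintype.card β) l -
            (∑ i, c i * rootOfUnity (q i) ^ (l i : ℕ)) * t)‖ := by rw [sub_sub_cancel]
      _ ≤ _ := norm_sub_le _ _

end Directions

/-! ### Isospectrality and periodicity of averages. -/

section Average

variable {ι α β : Type*} [Fintype ι] [DecidableEq ι] [Fintype α] [DecidableEq α] [Fintype β]
  [DecidableEq β]

theorem dispersion_sub_const (q : α → ℕ+) (V : (α → ℤ) → ℂ) (c : ℂ) (k : α → ℂ) (lam : ℂ) :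
    dispersion q (fun x => V x - c) k lam = dispersion q V k (lam + c) := by
  unfold dispersion
  congr 1
  rw [floquetMatrix_eq_add_diagonal, floquetMatrix_eq_add_diagonal q V]
  ext m m'
  simp only [Matrix.sub_apply, Matrix.add_apply, Matrix.diagonal_apply, Matrix.smul_apply,
    Matrix.one_apply, smul_eq_mul]
  split_ifs <;> ring

/-- The average over at least two variables of generalized Fermi isospectral potentials with
coprime periods: after a shift by the energies, they are Floquet isospectral. -/
theorem floquetIsospectral_cellAverage (e : α ⊕ β ≃ ι) (hβ : Nontrivial β) (q : ι → ℕ+)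
    (hq : Pairwise fun a b => Nat.Coprime (q a : ℕ) (q b : ℕ)) {V Y : (ι → ℤ) → ℂ} {lam₁ lam₂ : ℂ}
    (h : ∀ k : ι → ℝ,
      dispersion q V (fun i => (k i : ℂ)) lam₁ = dispersion q Y (fun i => (k i : ℂ)) lam₂) :
    FloquetIsospectral (fun a => q (e (Sum.inl a)))
      (fun x => cellAverage (fun b => q (e (Sum.inr b))) (fun n => V (n ∘ e.symm)) x - lam₁)
      (fun x => cellAverage (fun b => q (e (Sum.inr b))) (fun n => Y (n ∘ e.symm)) x - lam₂) := by
  intro k lam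
  rw [dispersion_sub_const, dispersion_sub_const]
  have hq' : Pairwise fun a b : β =>
      Nat.Coprime (q (e (Sum.inr a)) : ℕ) (q (e (Sum.inr b)) : ℕ) := fun a b hab =>
    hq fun hh => hab (Sum.inr_injective (e.injective hh))
  -- The limit `μ = -lam` turns the fixed energies into `lam₁ + lam` and `lam₂ + lam`, with `lam`
  -- arbitrary.
  obtain ⟨z, hz, h0, hl⟩ := exists_tendsto_freeEigenvalue hq' hβ (-lam)
  have hVY : ∀ κ : α ⊕ β → ℂ, dispersion (q ∘ e) (fun n => V (n ∘ e.symm)) κ lam₁ =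
      dispersion (q ∘ e) (fun n => Y (n ∘ e.symm)) κ lam₂ := by
    intro κ
    have hκ : κ = (κ ∘ e.symm) ∘ e := by ext; simp
    rw [hκ, dispersion_reindex, dispersion_reindex]
    exact dispersion_eq_of_real h _
  have := dispersion_cellAverage_eq hVY hz h0 hl fun a => (k a : ℂ)
  rwa [sub_neg_eq_add, sub_neg_eq_add, add_comm lam₁, add_comm lam₂] at this

omit [Fintype ι] [Fintype α] in
theorem isPeriodic_cellAverage (e : α ⊕ β ≃ ι) {q : ι → ℕ+} {V : (ι → ℤ) → ℂ}
    (hV : IsPeriodic q V) : IsPeriodic (fun a => q (e (Sum.inl a)))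
      (cellAverage (fun b => q (e (Sum.inr b))) fun n => V (n ∘ e.symm)) := by
  intro x a
  unfold cellAverage
  congr 1
  refine Finset.sum_congr rfl fun y _ => ?_
  refine Eq.trans ?_ (hV (Sum.elim x y.toLattice ∘ e.symm) (e (Sum.inl a)))
  refine congrArg V ?_
  ext i
  obtain ⟨c, rfl⟩ := e.surjective i
  rcases c with c | c <;> simp [Pi.single_apply]

end Average

/-! ### Coordinate blocks and the corrections in the last block. -/

section Blocks

variable {m : ℕ} {d : Fin (m + 1) → ℕ}

/-- The coordinates outside the block `j` and the last block. -/
abbrev RestCoord (d : Fin (m + 1) → ℕ) (j : Fin m) : Type :=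
  {c : Coord d // c.1 ≠ j.castSucc ∧ c.1 ≠ Fin.last m}

/-- The inclusion of the coordinates of the block `j` and the last block. -/
def pairInclusion (d : Fin (m + 1) → ℕ) (j : Fin m) : PairCoord d j → Coord d :=
  Sum.elim (fun i => ⟨j.castSucc, i⟩) (fun i => ⟨Fin.last m, i⟩)

theorem pairBlocks_apply {γ : Type*} (x : Coord d → γ) (j : Fin m) (c : PairCoord d j) :
    pairBlocks x j c = x (pairInclusion d j c) := by
  rcases c with c | c <;> rfl

/-- The coordinates of the block `j` and the last block together with all the others. -/
def blockEquiv (d : Fin (m + 1) → ℕ) (j : Fin m) : PairCoord d j ⊕ RestCoord d j ≃ Coord d :=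
  Equiv.ofBijective (Sum.elim (pairInclusion d j) Subtype.val) <| by
    have hj : j.castSucc ≠ Fin.last m := (Fin.castSucc_lt_last j).ne
    constructor
    · refine Function.Injective.sumElim ?_ Subtype.val_injective ?_
      · refine Function.Injective.sumElim (sigma_mk_injective (β := fun i => Fin (d i)))
          (sigma_mk_injective (β := fun i => Fin (d i))) fun a b h => ?_
        exact hj (congrArg Sigma.fst h)
      · rintro (a | a) ⟨b, hb1, hb2⟩ rfl
        · exact hb1 rfl
        · exact hb2 rfl
    · intro c
      by_cases h1 : c.1 = j.castSucc
      · obtain ⟨i, c⟩ := c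
        subst h1
        exact ⟨Sum.inl (Sum.inl c), rfl⟩
      · by_cases h2 : c.1 = Fin.last m
        · obtain ⟨i, c⟩ := c
          subst h2
          exact ⟨Sum.inl (Sum.inr c), rfl⟩
        · exact ⟨Sum.inr ⟨c, h1, h2⟩, rfl⟩

theorem blockEquiv_inl (j : Fin m) (c : PairCoord d j) :
    blockEquiv d j (Sum.inl c) = pairInclusion d j c := rfl

theorem blockEquiv_symm_pairInclusion (j : Fin m) (c : PairCoord d j) :
    (blockEquiv d j).symm (pairInclusion d j c) = Sum.inl c := by
  rw [← blockEquiv_inl, Equiv.symm_apply_apply]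

theorem blockEquiv_symm_rest (j : Fin m) (c : RestCoord d j) :
    (blockEquiv d j).symm c.1 = Sum.inr c :=
  (blockEquiv d j).symm_apply_apply (Sum.inr c)

/-- The dimension condition supplies the two averaged variables that the choice of direction
requires. -/
theorem nontrivial_restCoord {j : Fin m}
    (h : d j.castSucc + d (Fin.last m) + 2 ≤ ∑ i, d i) : Nontrivial (RestCoord d j) := by
  have h1 := Fintype.card_congr (blockEquiv d j)
  simp only [Fintype.card_sum, Fintype.card_fin, Fintype.card_sigma] at h1
  rw [← Fintype.one_lt_card_iff_nontrivial]
  omega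

theorem pairBlocks_sumElim_self {γ : Type*} (j : Fin m) (x : PairCoord d j → γ)
    (y : RestCoord d j → γ) : pairBlocks (Sum.elim x y ∘ (blockEquiv d j).symm) j = x := by
  ext c
  rw [pairBlocks_apply, Function.comp_apply, blockEquiv_symm_pairInclusion, Sum.elim_inl]

/-- A component with index `i ≠ j` sees the last block and averaged variables, but not the block
`j`. -/
theorem pairBlocks_sumElim_congr {γ : Type*} {i j : Fin m} (hij : i ≠ j)
    {x x' : PairCoord d j → γ} (hx : x ∘ Sum.inr = x' ∘ Sum.inr) (y : RestCoord d j → γ) :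
    pairBlocks (Sum.elim x y ∘ (blockEquiv d j).symm) i =
      pairBlocks (Sum.elim x' y ∘ (blockEquiv d j).symm) i := by
  ext c
  simp only [pairBlocks_apply, Function.comp_apply]
  rcases c with c | c
  · have hr : (pairInclusion d i (Sum.inl c)).1 ≠ j.castSucc ∧
        (pairInclusion d i (Sum.inl c)).1 ≠ Fin.last m :=
      ⟨fun h => hij (Fin.castSucc_injective _ h), (Fin.castSucc_lt_last i).ne⟩
    rw [blockEquiv_symm_rest j ⟨_, hr⟩]
    rfl
  · rw [show pairInclusion d i (Sum.inr c) = pairInclusion d j (Sum.inr c) from rfl,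
      blockEquiv_symm_pairInclusion]
    exact congrFun hx c

/-- The average of a potential `V` over the variables outside the block `j` and the last block. -/
def blockAverage (q : Coord d → ℕ+) (V : (Coord d → ℤ) → ℂ) (j : Fin m) :
    (PairCoord d j → ℤ) → ℂ :=
  cellAverage (fun b => q (blockEquiv d j (Sum.inr b))) fun n => V (n ∘ (blockEquiv d j).symm)

/-- With the last block fixed, all components but `Vc j` cancel in the difference, which is then
constant in the averaged variables. -/
theorem blockAverage_sub (q : Coord d → ℕ+) {V : (Coord d → ℤ) → ℂ}
    {Vc : (j : Fin m) → (PairCoord d j → ℤ) → ℂ} (hVc : ∀ n, V n = ∑ j, Vc j (pairBlocks n j))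
    {j : Fin m} {x x' : PairCoord d j → ℤ} (hx : x ∘ Sum.inr = x' ∘ Sum.inr) :
    blockAverage q V j x - blockAverage q V j x' = Vc j x - Vc j x' := by
  have hy : ∀ y : RestCoord d j → ℤ, V (Sum.elim x y ∘ (blockEquiv d j).symm) -
      V (Sum.elim x' y ∘ (blockEquiv d j).symm) = Vc j x - Vc j x' := by
    intro y
    rw [hVc, hVc, ← Finset.sum_sub_distrib, Finset.sum_eq_single j]
    · rw [pairBlocks_sumElim_self, pairBlocks_sumElim_self]
    · intro i _ hij
      rw [pairBlocks_sumElim_congr hij hx, sub_self]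
    · simp
  unfold blockAverage cellAverage
  rw [← mul_sub, ← Finset.sum_sub_distrib]
  simp only [hy, Finset.sum_const, Finset.card_univ, nsmul_eq_mul]
  rw [inv_mul_cancel_left₀]
  have : Nonempty (Cell fun b : RestCoord d j => q (blockEquiv d j (Sum.inr b))) := ⟨cellZero _⟩
  exact_mod_cast Fintype.card_ne_zero

/-- The correction of the component `Vc j`, a function of the last block of variables, which turns
it into the average of `V` minus `lam`. -/
def blockCorrection (q : Coord d → ℕ+) (V : (Coord d → ℤ) → ℂ)
    (Vc : (j : Fin m) → (PairCoord d j → ℤ) → ℂ) (lam : ℂ) (j : Fin m)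
    (s : Fin (d (Fin.last m)) → ℤ) : ℂ :=
  blockAverage q V j (Sum.elim 0 s) - Vc j (Sum.elim 0 s) - lam

/-- The average minus `Vc j` depends on the last block alone, so the base point `0` chosen in the
block `j` is immaterial. -/
theorem add_blockCorrection (q : Coord d → ℕ+) {V : (Coord d → ℤ) → ℂ}
    {Vc : (j : Fin m) → (PairCoord d j → ℤ) → ℂ} (hVc : ∀ n, V n = ∑ j, Vc j (pairBlocks n j))
    (lam : ℂ) (j : Fin m) :
    (fun x => Vc j x + blockCorrection q V Vc lam j (x ∘ Sum.inr)) =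
      fun x => blockAverage q V j x - lam := by
  ext x
  have h := blockAverage_sub q hVc (j := j) (x := x) (x' := Sum.elim 0 (x ∘ Sum.inr)) rfl
  simp only [blockCorrection]
  linear_combination -h

theorem isPeriodic_blockAverage_sub {q : Coord d → ℕ+} {V : (Coord d → ℤ) → ℂ}
    (hV : IsPeriodic q V) (lam : ℂ) (j : Fin m) :
    IsPeriodic (pairBlocks q j) fun x => blockAverage q V j x - lam := by
  rw [show pairBlocks q j = fun a => q (blockEquiv d j (Sum.inl a)) from
    funext fun c => pairBlocks_apply q j c]
  exact fun x a => congrArg (· - lam) (isPeriodic_cellAverage (blockEquiv d j) hV x a)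

end Blocks

end PeriodicSchrodinger
end

/-- Here `r = m + 1`. -/
theorem mainTheorem4 (m : ℕ) (hr : 3 ≤ m + 1) (d : Fin (m + 1) → ℕ)
    (hd : ∀ j, 1 ≤ d j)
    (hd2 : ∀ j : Fin m, d j.castSucc + d (Fin.last m) + 2 ≤ ∑ i, d i)
    (q : PeriodicSchrodinger.Coord d → ℕ+)
    (hq : Pairwise fun a b => Nat.Coprime (q a : ℕ) (q b : ℕ))
    (V Y : (PeriodicSchrodinger.Coord d → ℤ) → ℂ)
    (hV : PeriodicSchrodinger.IsPeriodic q V) (hY : PeriodicSchrodinger.IsPeriodic q Y)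
    (hVY : PeriodicSchrodinger.GeneralizedFermiIsospectral q V Y)
    (Vc Yc : (j : Fin m) → (PeriodicSchrodinger.PairCoord d j → ℤ) → ℂ)
    (hVc : ∀ n, V n = ∑ j, Vc j (PeriodicSchrodinger.pairBlocks n j))
    (hYc : ∀ n, Y n = ∑ j, Yc j (PeriodicSchrodinger.pairBlocks n j)) :
    ∃ U₁ U₂ : Fin m → (Fin (d (Fin.last m)) → ℤ) → ℂ, ∀ j : Fin m,
      PeriodicSchrodinger.IsPeriodic (PeriodicSchrodinger.pairBlocks q j)
        (fun x => Vc j x + U₁ j (x ∘ Sum.inr)) ∧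
      PeriodicSchrodinger.IsPeriodic (PeriodicSchrodinger.pairBlocks q j)
        (fun x => Yc j x + U₂ j (x ∘ Sum.inr)) ∧
      PeriodicSchrodinger.FloquetIsospectral (PeriodicSchrodinger.pairBlocks q j)
        (fun x => Vc j x + U₁ j (x ∘ Sum.inr))
        (fun x => Yc j x + U₂ j (x ∘ Sum.inr)) := by
  obtain ⟨lam₁, lam₂, h⟩ := hVY
  refine ⟨PeriodicSchrodinger.blockCorrection q V Vc lam₁,
    PeriodicSchrodinger.blockCorrection q Y Yc lam₂, fun j => ?_⟩
  rw [PeriodicSchrodinger.add_blockCorrection q hVc, PeriodicSchrodinger.add_blockCorrection q hYc]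
  refine ⟨PeriodicSchrodinger.isPeriodic_blockAverage_sub hV lam₁ j,
    PeriodicSchrodinger.isPeriodic_blockAverage_sub hY lam₂ j, ?_⟩
  rw [show PeriodicSchrodinger.pairBlocks q j =
      fun a => q (PeriodicSchrodinger.blockEquiv d j (Sum.inl a)) from
    funext fun c => PeriodicSchrodinger.pairBlocks_apply q j c]
  exact PeriodicSchrodinger.floquetIsospectral_cellAverage (PeriodicSchrodinger.blockEquiv d j)
    (PeriodicSchrodinger.nontrivial_restCoord (hd2 j)) q hq h
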